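/- **Definitions.** A two-colored partition $p$ consists of two finite totally ordered rows of points (the upper and the lower row), a coloring of all points with the colors $\circ$ and $\bullet$, and a decomposition of the set of all points into blocks; it is considered up to color-preserving isomorphism. It is a pair partition if every block has exactly two points. Let $\mathcal P^{\circ\bullet}$ be the set of all two-colored partitions. The tensor product $p\otimes p'$ appends each row of $p'$ at the right end of the respective row of $p$; the involution $p^*$ exchanges the two rows; if the lower row of $p'$ and the upper row of $p$ agree in size and coloration, the composition $pp'$ has the upper row of $p'$ and the lower row of $p$, and is obtained by gluing $p'$ on top of $p$ along the common row, joining blocks that meet there, and deleting the common row. A category is a subset of $\mathcal P^{\circ\bullet}$ that is closed under tensor products, involutions and compositions and contains the two one-block partitions with one upper and one lower point, both of the same color ($\circ$ or $\bullet$), and the two one-block partitions with no upper point and two lower points, colored $\bullet\circ$ and $\circ\bullet$. For $\mathcal G\subseteq\mathcal P^{\circ\bullet}$ let $\langle\mathcal G\rangle$ be the smallest category that contains $\mathcal G$. The points of $p$ are ordered cyclically: the lower row from left to right, then the upper row from right to left. Intervals $]\alpha,\beta[_p$, $]\alpha,\beta]_p$, $[\alpha,\beta]_p$ refer to this cyclic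 order, with $]\alpha,\alpha]_p=\emptyset$ and $[\alpha,\alpha]_p=\{\alpha\}$. The normalized color of a lower point is its color, that of an upper point is the inverse of its color. For a set $S$ of points, $\sigma_p(S)$ is the number of points of $S$ of normalized color $\circ$ minus the number of those of normalized color $\bullet$. A sector is a proper subset of the set of points of the form $[\alpha,\beta]_p$ such that $\{\alpha,\beta\}$ is a block. Two blocks $B,B'$ cross if there are pairwise distinct $\alpha,\beta\in B$, $\gamma,\delta\in B'$ that occur in the cyclic order $(\alpha,\gamma,\beta,\delta)$. Let $\mathcal S_0$ be the set of all pair partitions $p$ with $\sigma_p(B)=0$ for all blocks $B$ and $\sigma_p(S)=0$ for all sectors $S$ of $p$. For $p\in\mathcal S_0$ and blocks $B\ni\alpha$, $B'\ni\alpha'$ of $p$, the color distance $d_p(B,B')$ is $|\sigma_p(]\alpha,\alpha'[_p)|$ if $\alpha,\alpha'$ have different normalized colors and $|\sigma_p(]\alpha,\alpha']_p)|$ if they have the same normalized color; it does not depend on the choice of $\alpha\in B$ and $\alpha'\in B'$. For a subsemigroup $D$ of $(\mathbb N_0,+)$ (possibly empty), let $\mathcal I_D$ be the set of all $p\in\mathcal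 S_0$ such that any two blocks $B,B'$ of $p$ with $d_p(B,B')\in D$ do not cross. **Corollary.** Let $D$ be a subsemigroup of $(\mathbb N_0,+)$ such that $\mathbb N\setminus D$ is infinite, where $\mathbb N=\{1,2,\dots\}$. Then $\mathcal I_D$ is a category, and every set $\mathcal G\subseteq\mathcal P^{\circ\bullet}$ with $\langle\mathcal G\rangle=\mathcal I_D$ is infinite. In particular, there is a category of two-colored partitions that is not generated by any finite set of partitions. -/

import Mathlib

namespace TwoColored

/-- The two colors of points. -/
inductive Color : Type
  | white : Color
  | black : Color
  deriving DecidableEq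

/-- The inverse color. -/
def Color.inv : Color → Color
  | .white => .black
  | .black => .white

/-- The density of the color sum: `1` for white, `-1` for black. -/
def Color.sign : Color → ℤ
  | .white => 1
  | .black => -1

/-- The points of a partition whose upper row is colored by `u` and whose lower row is colored
by `l` (both rows read from left to right): the disjoint union of the two rows. -/
abbrev Points (u l : List Color) : Type := Fin u.length ⊕ Fin l.length

/-- A two-colored partition. A finite totally ordered set with a coloring is recorded as the list
of its colors from left to right; the decomposition of the points into blocks is recorded as an
equivalence relation, whose classes are the blocks. -/
structure ColPartition : Type where
  /-- colors of the upper row, from left to right -/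
  upper : List Color
  /-- colors of the lower row, from left to right -/
  lower : List Color
  /-- the decomposition of the points into blocks -/
  rel : Setoid (Points upper lower)

/-! ### Category operations -/

/-- The decomposition of the points of `p ⊗ p'` into those of `p` (on the left) and those of `p'`
(on the right), in both rows. -/
def tensorSplit (u u' l l' : List Color) :
    Points (u ++ u') (l ++ l') → Points u l ⊕ Points u' l' :=
  Sum.elim
    (fun i => Sum.map Sum.inl Sum.inl (finSumFinEquiv.symm (Fin.cast List.length_append i)))
    (fun j => Sum.map Sum.inr Sum.inr (finSumFinEquiv.symm (Fin.cast List.length_append j)))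

/-- The disjoint union of two equivalence relations. -/
def sumSetoid {X Y : Type} (r : Setoid X) (s : Setoid Y) : Setoid (X ⊕ Y) where
  r := Sum.LiftRel r s
  iseqv :=
    { refl := by
        rintro (x | y)
        · exact Sum.LiftRel.inl (r.refl' x)
        · exact Sum.LiftRel.inr (s.refl' y)
      symm := by
        rintro _ _ (h | h)
        · exact Sum.LiftRel.inl (r.symm' h)
        · exact Sum.LiftRel.inr (s.symm' h)
      trans := by
        rintro _ _ _ (h | h) (h' | h')
        · exact Sum.LiftRel.inl (r.trans' h h')
        · exact Sum.LiftRel.inr (s.trans' h h') }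

/-- The tensor product `p ⊗ p'`: each row of `p'` is appended at the right end of the
respective row of `p`. -/
def ColPartition.tensor (p p' : ColPartition) : ColPartition where
  upper := p.upper ++ p'.upper
  lower := p.lower ++ p'.lower
  rel := (sumSetoid p.rel p'.rel).comap (tensorSplit p.upper p'.upper p.lower p'.lower)

/-- The involution `p*`: the two rows exchange their roles. -/
def ColPartition.involution (p : ColPartition) : ColPartition where
  upper := p.lower
  lower := p.upper
  rel := p.rel.comap Sum.swap

/-- The equivalence relation of the composition `p p'`, where `r` is that of `p` (upper row `v`,
lower row `w`) and `r'` is that of `p'` (upper row `u`, lower row `v`): the rows `u`, `v`, `w` are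
put on top of each other, the equivalence relation generated by `r'` on `u`, `v` and by `r` on
`v`, `w` is formed, and the result is restricted to `u` and `w`. -/
def compRel {u v w : List Color} (r : Setoid (Points v w)) (r' : Setoid (Points u v)) :
    Setoid (Points u w) :=
  (Relation.EqvGen.setoid
    (fun x y : Fin u.length ⊕ (Fin v.length ⊕ Fin w.length) =>
      Relation.Map r' (Sum.map id Sum.inl) (Sum.map id Sum.inl) x y ∨
      Relation.Map r Sum.inr Sum.inr x y)).comap (Sum.map id Sum.inr)

/-- A category of partitions: a set of two-colored partitions that is closed under tensor
products, involutions and compositions of composable pairs, and that contains the identity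
partitions of both colors and the two partitions with empty upper row that have a single block
consisting of two lower points of different colors. -/
structure IsCategory (C : Set ColPartition) : Prop where
  tensor_mem : ∀ p p' : ColPartition, p ∈ C → p' ∈ C → p.tensor p' ∈ C
  involution_mem : ∀ p : ColPartition, p ∈ C → p.involution ∈ C
  comp_mem : ∀ (u v w : List Color) (r : Setoid (Points v w)) (r' : Setoid (Points u v)),
    ColPartition.mk v w r ∈ C → ColPartition.mk u v r' ∈ C → ColPartition.mk u w (compRel r r') ∈ C
  id_white_mem : ColPartition.mk [Color.white] [Color.white] ⊤ ∈ C
  id_black_mem : ColPartition.mk [Color.black] [Color.black] ⊤ ∈ C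
  pair_black_white_mem : ColPartition.mk [] [Color.black, Color.white] ⊤ ∈ C
  pair_white_black_mem : ColPartition.mk [] [Color.white, Color.black] ⊤ ∈ C

/-- The category `⟨G⟩` generated by a set `G` of partitions. -/
def generated (G : Set ColPartition) : Set ColPartition :=
  ⋂₀ {C : Set ColPartition | IsCategory C ∧ G ⊆ C}

/-- `⟨G⟩` is indeed the smallest category that contains `G`. -/
theorem isLeast_generated (G : Set ColPartition) :
    IsLeast {C : Set ColPartition | IsCategory C ∧ G ⊆ C} (generated G) := by
  refine ⟨⟨?_, fun p hp C hC => hC.2 hp⟩, fun C hC => Set.sInter_subset_of_mem hC⟩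
  exact
    { tensor_mem := fun p p' hp hp' C hC => hC.1.tensor_mem p p' (hp C hC) (hp' C hC)
      involution_mem := fun p hp C hC => hC.1.involution_mem p (hp C hC)
      comp_mem := fun u v w r r' h h' C hC => hC.1.comp_mem u v w r r' (h C hC) (h' C hC)
      id_white_mem := fun C hC => hC.1.id_white_mem
      id_black_mem := fun C hC => hC.1.id_black_mem
      pair_black_white_mem := fun C hC => hC.1.pair_black_white_mem
      pair_white_black_mem := fun C hC => hC.1.pair_white_black_mem }

/-! ### Orientation, color sum, sectors, crossings, color distance -/

namespace ColPartition

variable (p : ColPartition)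

/-- The points of `p`. -/
abbrev Pt : Type := Points p.upper p.lower

/-- The blocks of `p`. -/
def blocks : Set (Set p.Pt) := p.rel.classes

/-- The position of a point when the points are enumerated along the orientation, that is,
first the lower row from left to right, then the upper row from right to left. -/
def pos : p.Pt → ℕ :=
  Sum.elim (fun i => p.lower.length + (p.upper.length - 1 - i)) (fun j => j)

/-- The points `a`, `b`, `c` are pairwise distinct and occur in the order `(a, b, c)` with respect
to the cyclic order of the points (the orientation). -/
def Between (a b c : p.Pt) : Prop :=
  (p.pos a < p.pos b ∧ p.pos b < p.pos c) ∨
  (p.pos b < p.pos c ∧ p.pos c < p.pos a) ∨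
  (p.pos c < p.pos a ∧ p.pos a < p.pos b)

/-- The open interval `]a, b[` of the cyclic order. -/
def openInterval (a b : p.Pt) : Set p.Pt := {c | p.Between a c b}

/-- The half-open interval `]a, b]` of the cyclic order (empty if `a = b`). -/
def halfOpenInterval (a b : p.Pt) : Set p.Pt := {c | c ≠ a ∧ (p.Between a c b ∨ c = b)}

/-- The closed interval `[a, b]` of the cyclic order. -/
def closedInterval (a b : p.Pt) : Set p.Pt := {c | c = a ∨ p.Between a c b ∨ c = b}

/-- The normalized color of a point: the native color of a lower point, the inverse of the native
color of an upper point. -/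
def normColor : p.Pt → Color :=
  Sum.elim (fun i => (p.upper.get i).inv) (fun j => p.lower.get j)

/-- The color sum `σ_p(S)` of a set `S` of points: the number of points in `S` of normalized color
white minus the number of those of normalized color black. -/
noncomputable def colorSum (S : Set p.Pt) : ℤ :=
  ∑ a : p.Pt, S.indicator (fun b => (p.normColor b).sign) a

/-- `S` is a sector: a proper subset of the points that is an interval of the cyclic order and
whose set of first and last point is a block. -/
def IsSector (S : Set p.Pt) : Prop :=
  S ≠ Set.univ ∧ ∃ a b : p.Pt, S = p.closedInterval a b ∧ {a, b} ∈ p.blocks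

/-- The blocks `B` and `B'` cross. -/
def Cross (B B' : Set p.Pt) : Prop :=
  ∃ a ∈ B, ∃ b ∈ B, ∃ c ∈ B', ∃ d ∈ B', p.Between a c b ∧ p.Between b d a

/-- The signed color distance `δ_p(a, b)` from the point `a` to the point `b`. -/
noncomputable def signedDist (a b : p.Pt) : ℤ :=
  if p.normColor a = p.normColor b then p.colorSum (p.halfOpenInterval a b)
  else p.colorSum (p.openInterval a b)

/-- The absolute color distance `d_p(a, b) = |δ_p(a, b)|`. -/
noncomputable def dist (a b : p.Pt) : ℕ := (p.signedDist a b).natAbs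

end ColPartition

/-- The set of all pair partitions all of whose blocks are neutral. -/
def pairNeutral : Set ColPartition :=
  {p | ∀ B ∈ p.blocks, B.ncard = 2 ∧ p.colorSum B = 0}

/-- The set `S₀` of all pair partitions with neutral blocks all of whose sectors are neutral. -/
def SZero : Set ColPartition :=
  {p | p ∈ pairNeutral ∧ ∀ S : Set p.Pt, p.IsSector S → p.colorSum S = 0}

/-- The set `I_D` of all `p ∈ S₀` such that no two blocks of `p` whose color distance lies in `D`
cross. For `p ∈ S₀` the color distance of two points depends only on their blocks, so the distance
of two blocks may be computed from any of their points. -/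
def I (D : AddSubsemigroup ℕ) : Set ColPartition :=
  {p | p ∈ SZero ∧ ∀ B ∈ p.blocks, ∀ B' ∈ p.blocks, ∀ a ∈ B, ∀ a' ∈ B',
    p.dist a a' ∈ D → ¬ p.Cross B B'}

end TwoColored

/-!
Read along its row, a word of colors describes a lattice path, and every point of a partition sits
at a level of this path. Neutrality of the blocks and of the sectors of a pair partition says
that partners have opposite normalized colors and equal levels, and the color distance of two
blocks is then the difference of their levels. Two strings do not cross exactly if they cross an
even number of times. This parity is a sum of contributions of single points that telescopes along
the strings of a composition, so for *every* set `D` of level distances, semigroup or not,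
the partitions whose strings at a level distance in `D` cross evenly form a category.

A finite subset of `I D` involves only finitely many level distances, so for some `N` it lies in
the category of `D ∪ {k | N ≤ k}`. But `I D` itself does not: for `n ≥ N` outside of `D`, take two
rows colored `∘ⁿ⁺¹•ⁿ⁺¹`, join the points whose level is in `D ∪ {0}` horizontally and all others
vertically. As `D` is a semigroup, no two strings at a distance in `D` cross, whereas the
horizontal string of level `0` crosses the vertical string of level `n`.
-/

namespace TwoColored

section Pairing

variable {X : Type*} {r : Setoid X} {σ : X → X}

/-- The classes of `r` are the two-element sets `{x, σ x}`, that is, `r` is a pair partition and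
`σ` maps every point to its partner. -/
structure IsPairing (r : Setoid X) (σ : X → X) : Prop where
  ne : ∀ x, σ x ≠ x
  rel_iff : ∀ x y, r x y ↔ y = x ∨ y = σ x

theorem IsPairing.rel_apply (h : IsPairing r σ) (x : X) : r x (σ x) :=
  (h.rel_iff _ _).2 (Or.inr rfl)

theorem IsPairing.involutive (h : IsPairing r σ) : Function.Involutive σ := fun x =>
  (((h.rel_iff _ _).1 (r.symm' (h.rel_apply x))).resolve_left (h.ne x).symm).symm

theorem IsPairing.apply_eq_iff (h : IsPairing r σ) {x y : X} : σ x = y ↔ x = σ y :=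
  ⟨fun e => e ▸ (h.involutive x).symm, fun e => e ▸ h.involutive y⟩

theorem IsPairing.pair_mem_classes (h : IsPairing r σ) (x : X) : {x, σ x} ∈ r.classes := by
  refine ⟨x, Set.ext fun z => ?_⟩
  rw [Set.mem_insert_iff, Set.mem_singleton_iff, ← h.rel_iff]
  exact ⟨r.symm', r.symm'⟩

theorem IsPairing.eq_pair_of_mem (h : IsPairing r σ) {B : Set X} (hB : B ∈ r.classes) {x : X}
    (hx : x ∈ B) : B = {x, σ x} :=
  Setoid.eq_of_mem_classes hB hx (h.pair_mem_classes x) (Set.mem_insert x _)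

theorem IsPairing.exists_eq_pair (h : IsPairing r σ) {B : Set X} (hB : B ∈ r.classes) :
    ∃ x, B = {x, σ x} := by
  obtain ⟨x, rfl⟩ := hB
  exact ⟨x, h.eq_pair_of_mem ⟨x, rfl⟩ (r.refl' x)⟩

theorem IsPairing.sum_eq_zero [Fintype X] {M : Type*} [AddCommGroup M] (h : IsPairing r σ)
    {f : X → M} (hf : ∀ x, f (σ x) = -f x) : ∑ x, f x = 0 :=
  Finset.sum_involution (fun x _ => σ x) (fun x _ => by rw [hf, add_neg_cancel])
    (fun x _ _ => h.ne x) (fun _ _ => Finset.mem_univ _) (fun x _ => h.involutive x)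

theorem IsPairing.unique {τ : X → X} (h : IsPairing r σ) (h' : IsPairing r τ) : σ = τ :=
  funext fun x => ((h'.rel_iff x _).1 (h.rel_apply x)).resolve_left (h.ne x)

/-- The equivalence relation whose classes are the orbits `{x, σ x}` of an involution `σ`. -/
def involutionSetoid (hσ : σ.Involutive) : Setoid X where
  r x y := y = x ∨ y = σ x
  iseqv :=
    { refl := fun _ => .inl rfl
      symm := by
        rintro x _ (rfl | rfl)
        exacts [.inl rfl, .inr (hσ x).symm]
      trans := by
        rintro x _ _ (rfl | rfl) (rfl | rfl)
        exacts [.inl rfl, .inr rfl, .inr rfl, .inl (hσ x)] }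

theorem isPairing_involutionSetoid (hσ : σ.Involutive) (hne : ∀ x, σ x ≠ x) :
    IsPairing (involutionSetoid hσ) σ :=
  ⟨hne, fun _ _ => Iff.rfl⟩

theorem exists_isPairing_of_existsUnique (h : ∀ x, ∃! y, y ≠ x ∧ r x y) :
    ∃ σ, IsPairing r σ := by
  choose σ hσ huniq using h
  refine ⟨σ, fun x => (hσ x).1, fun x y => ⟨fun hxy => ?_, ?_⟩⟩
  · exact or_iff_not_imp_left.2 fun hy => huniq x y ⟨hy, hxy⟩
  · rintro (rfl | rfl)
    exacts [r.refl' _, (hσ x).2]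

theorem exists_isPairing_of_ncard_eq_two (h : ∀ B ∈ r.classes, B.ncard = 2) :
    ∃ σ, IsPairing r σ := by
  refine exists_isPairing_of_existsUnique fun x => ?_
  obtain ⟨a, b, hab, hB⟩ := Set.ncard_eq_two.1 (h {y | r y x} ⟨x, rfl⟩)
  have hx : ∀ y, r x y ↔ y = a ∨ y = b := fun y =>
    ⟨fun hxy => hB.subset (r.symm' hxy), fun hy => r.symm' (hB.superset hy)⟩
  rcases (hx x).1 (r.refl' x) with rfl | rfl
  · exact ⟨b, ⟨hab.symm, (hx b).2 (Or.inr rfl)⟩, fun y hy => ((hx y).1 hy.2).resolve_left hy.1⟩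
  · exact ⟨a, ⟨hab, (hx a).2 (Or.inl rfl)⟩, fun y hy => ((hx y).1 hy.2).resolve_right hy.1⟩

theorem IsPairing.comap_equiv {Y : Type*} (h : IsPairing r σ) (e : Y ≃ X) :
    IsPairing (r.comap e) (e.symm ∘ σ ∘ e) where
  ne y hy := h.ne (e y) (e.symm_apply_eq.1 hy)
  rel_iff x y := by
    rw [Setoid.comap_rel, h.rel_iff, e.apply_eq_iff_eq, Function.comp_apply, Function.comp_apply,
      e.eq_symm_apply]

theorem IsPairing.sumSetoid {X Y : Type} {r : Setoid X} {s : Setoid Y} {σ : X → X} {τ : Y → Y}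
    (hσ : IsPairing r σ) (hτ : IsPairing s τ) : IsPairing (sumSetoid r s) (Sum.map σ τ) where
  ne := by
    rintro (x | y)
    exacts [fun e => hσ.ne x (Sum.inl_injective e), fun e => hτ.ne y (Sum.inr_injective e)]
  rel_iff x y := by
    change Sum.LiftRel r s x y ↔ _
    rcases x with x | x <;> rcases y with y | y <;> simp [hσ.rel_iff, hτ.rel_iff]

theorem IsPairing.sum_class_eq {Y M : Type*} [AddCommMonoid M] {R : Setoid Y} {ι : X → Y}
    (hι : Function.Injective ι) (h : IsPairing (R.comap ι) σ) {f : Y → M}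
    (hf : ∀ z ∉ Set.range ι, f z = 0) {c : X} {s : Finset Y} (hs : ∀ z, z ∈ s ↔ R (ι c) z) :
    ∑ z ∈ s, f z = f (ι c) + f (ι (σ c)) := by
  classical
  rw [← Finset.sum_pair (hι.ne (h.ne c).symm)]
  symm
  refine Finset.sum_subset (fun z hz => ?_) fun z hz hzc => hf z ?_
  · rw [Finset.mem_insert, Finset.mem_singleton] at hz
    rw [hs]
    rcases hz with rfl | rfl
    exacts [R.refl' _, h.rel_apply c]
  · rintro ⟨y, rfl⟩
    rcases (h.rel_iff c y).1 ((hs _).1 hz) with rfl | rfl <;> simp at hzc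

end Pairing

section Alternating

variable {X : Type*} {S T : X → X}

/-- The equivalence relation whose classes are the orbits of the group generated by two
involutions `S` and `T`. -/
def alternatingSetoid (S T : X → X) : Setoid X :=
  Relation.EqvGen.setoid fun z y => y = S z ∨ y = T z

theorem alternatingSetoid_comm (S T : X → X) : alternatingSetoid S T = alternatingSetoid T S := by
  simp only [alternatingSetoid, or_comm]

theorem alternatingSetoid_left (S T : X → X) (z : X) : alternatingSetoid S T z (S z) :=
  .rel _ _ (Or.inl rfl)

theorem alternatingSetoid_right (S T : X → X) (z : X) : alternatingSetoid S T z (T z) :=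
  .rel _ _ (Or.inr rfl)

theorem alternatingSetoid_induction (hS : S.Involutive) (hT : T.Involutive) {P : X → Prop}
    (hPS : ∀ z, P z → P (S z)) (hPT : ∀ z, P z → P (T z)) {x y : X}
    (hxy : alternatingSetoid S T x y) (hx : P x) : P y := by
  have hle : alternatingSetoid S T ≤ Setoid.ker P := Setoid.eqvGen_le <| by
    rintro z _ (rfl | rfl)
    · exact propext ⟨hPS z, fun h => hS z ▸ hPS _ h⟩
    · exact propext ⟨hPT z, fun h => hT z ▸ hPT _ h⟩
  exact (hle hxy : P x = P y) ▸ hx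

theorem iterate_comp_apply_reflect (hS : S.Involutive) (hT : T.Involutive) {x : X} (hx : T x = x)
    (k : ℕ) : (T ∘ S)^[k] (T ((T ∘ S)^[k] x)) = x := by
  induction k with
  | zero => exact hx
  | succ k ih =>
    rw [Function.iterate_succ_apply' _ _ x, Function.iterate_succ_apply, Function.comp_apply,
      Function.comp_apply, hT, hS, ih]

open Function in
theorem right_iterate_of_le_minimalPeriod (hS : S.Involutive) (hT : T.Involutive) {x : X}
    (hx : T x = x) {k : ℕ} (hk : k ≤ minimalPeriod (T ∘ S) x) :
    T ((T ∘ S)^[k] x) = (T ∘ S)^[minimalPeriod (T ∘ S) x - k] x :=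
  (hT.injective.comp hS.injective).iterate k <| by
    rw [iterate_comp_apply_reflect hS hT hx, ← iterate_add_apply, Nat.add_sub_cancel' hk,
      iterate_minimalPeriod]

open Function in
theorem left_iterate_of_lt_minimalPeriod (hS : S.Involutive) (hT : T.Involutive) {x : X}
    (hx : T x = x) {k : ℕ} (hk : k < minimalPeriod (T ∘ S) x) :
    S ((T ∘ S)^[k] x) = (T ∘ S)^[minimalPeriod (T ∘ S) x - (k + 1)] x := by
  rw [← right_iterate_of_le_minimalPeriod hS hT hx hk, iterate_succ_apply', comp_apply, hT]

theorem alternatingSetoid_iterate (S T : X → X) (x : X) (k : ℕ) :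
    alternatingSetoid S T x ((T ∘ S)^[k] x) := by
  induction k with
  | zero => exact Setoid.refl' _ x
  | succ k ih =>
    rw [Function.iterate_succ_apply']
    exact Setoid.trans' _ ih
      (Setoid.trans' _ (alternatingSetoid_left S T _) (alternatingSetoid_right S T _))

open Function in
/-- Two involutions act on the orbit of a fixed point `x` of `T` as on the points
`x, ρ x, …, ρⁿ⁻¹ x` of an `n`-gon, where `ρ = T ∘ S`: the reflections are `k ↦ n - k` and
`k ↦ n - 1 - k`, so the only further fixed point is at `k = ⌊n / 2⌋`. -/
theorem existsUnique_fixed_of_right_fixed [Finite X] (hS : S.Involutive) (hT : T.Involutive)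
    (hST : ∀ z, S z = z → T z ≠ z) {x : X} (hx : T x = x) :
    ∃! y, y ≠ x ∧ alternatingSetoid S T x y ∧ (S y = y ∨ T y = y) := by
  have hTρ {k} := right_iterate_of_le_minimalPeriod hS hT hx (k := k)
  have hSρ {k} := left_iterate_of_lt_minimalPeriod hS hT hx (k := k)
  set ρ := T ∘ S
  set n := minimalPeriod ρ x
  have hnpos : 0 < n :=
    minimalPeriod_pos_of_mem_periodicPts ((hT.injective.comp hS.injective).mem_periodicPts x)
  have hinj : ∀ {j k}, j < n → k < n → (ρ^[j] x = ρ^[k] x ↔ j = k) := fun hj hk =>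
    iterate_eq_iterate_iff_of_lt_minimalPeriod hj hk
  have hfixed : ∀ k < n, k ≠ 0 → (S (ρ^[k] x) = ρ^[k] x ∨ T (ρ^[k] x) = ρ^[k] x ↔ k = n / 2) :=
    fun k hk hk0 => by
      rw [hSρ hk, hTρ hk.le, hinj (by omega) hk, hinj (by omega) hk]
      omega
  have horbit : ∀ y, alternatingSetoid S T x y → ∃ k < n, y = ρ^[k] x := fun y hxy => by
    refine alternatingSetoid_induction hS hT (P := fun y => ∃ k < n, y = ρ^[k] x) ?_ ?_ hxy
      ⟨0, hnpos, rfl⟩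
    · rintro _ ⟨k, hk, rfl⟩
      exact ⟨_, by omega, hSρ hk⟩
    · rintro _ ⟨k, hk, rfl⟩
      rcases Nat.eq_zero_or_pos k with rfl | hk0
      exacts [⟨0, hnpos, hx⟩, ⟨_, by omega, hTρ hk.le⟩]
  have hn1 : n ≠ 1 := fun h1 => hST x (by simpa [h1] using hSρ hnpos) hx
  have hne : ρ^[n / 2] x ≠ x := fun h => by
    have := (hinj (k := 0) (Nat.div_lt_self hnpos one_lt_two) hnpos).1 h
    omega
  refine ⟨ρ^[n / 2] x, ⟨hne, alternatingSetoid_iterate S T x _,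
    (hfixed _ (by omega) (by omega)).2 rfl⟩, ?_⟩
  rintro y ⟨hyx, hxy, hy⟩
  obtain ⟨k, hk, rfl⟩ := horbit y hxy
  rw [(hfixed k hk (by rintro rfl; exact hyx rfl)).1 hy]

theorem existsUnique_fixed [Finite X] (hS : S.Involutive) (hT : T.Involutive)
    (hST : ∀ z, S z = z → T z ≠ z) {x : X} (hx : S x = x ∨ T x = x) :
    ∃! y, y ≠ x ∧ alternatingSetoid S T x y ∧ (S y = y ∨ T y = y) := by
  rcases hx with hx | hx
  · simp only [or_comm (a := S _ = _)]
    rw [alternatingSetoid_comm S T]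
    exact existsUnique_fixed_of_right_fixed hT hS (fun z h h' => hST z h' h) hx
  · exact existsUnique_fixed_of_right_fixed hS hT hST hx

end Alternating

section ExtendAlong

variable {X Y : Type*} {ι : Y → X} {σ : Y → Y}

/-- The extension of a self-map `σ` of `Y` along `ι : Y → X`, by the identity off the range of
`ι`. -/
noncomputable def extendAlong (ι : Y → X) (σ : Y → Y) : X → X :=
  Function.extend ι (ι ∘ σ) id

theorem extendAlong_apply (hι : ι.Injective) (σ : Y → Y) (y : Y) :
    extendAlong ι σ (ι y) = ι (σ y) :=
  hι.extend_apply _ _ y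

theorem extendAlong_of_notMem_range (σ : Y → Y) {z : X} (hz : z ∉ Set.range ι) :
    extendAlong ι σ z = z :=
  Function.extend_apply' _ _ z hz

theorem extendAlong_involutive (hι : ι.Injective) (hσ : σ.Involutive) :
    (extendAlong ι σ).Involutive := fun z => by
  by_cases hz : z ∈ Set.range ι
  · obtain ⟨y, rfl⟩ := hz
    rw [extendAlong_apply hι, extendAlong_apply hι, hσ]
  · rw [extendAlong_of_notMem_range σ hz, extendAlong_of_notMem_range σ hz]

theorem extendAlong_eq_self_iff (hι : ι.Injective) (hσ : ∀ y, σ y ≠ y) {z : X} :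
    extendAlong ι σ z = z ↔ z ∉ Set.range ι := by
  refine ⟨?_, extendAlong_of_notMem_range σ⟩
  rintro hz ⟨y, rfl⟩
  exact hσ y (hι ((extendAlong_apply hι σ y).symm.trans hz))

theorem comp_extendAlong_eq {α : Type*} (hι : ι.Injective) {f : X → α}
    (hf : ∀ y, f (ι (σ y)) = f (ι y)) (z : X) : f (extendAlong ι σ z) = f z := by
  by_cases hz : z ∈ Set.range ι
  · obtain ⟨y, rfl⟩ := hz
    rw [extendAlong_apply hι, hf]
  · rw [extendAlong_of_notMem_range σ hz]

theorem sum_extend_eq_zero {M : Type*} [AddCommGroup M] (hι : ι.Injective)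
    (hσ : σ.Involutive) (hne : ∀ y, σ y ≠ y) {s : Finset X}
    (hs : ∀ z ∈ s, extendAlong ι σ z ∈ s) {f : Y → M} (hf : ∀ y, ι y ∈ s → f (σ y) = -f y) :
    ∑ z ∈ s, Function.extend ι f 0 z = 0 := by
  refine Finset.sum_involution (fun z _ => extendAlong ι σ z) (fun z hzs => ?_)
    (fun z _ hz => ?_) hs (fun z _ => extendAlong_involutive hι hσ z)
  all_goals by_cases hzι : z ∈ Set.range ι
  · obtain ⟨y, rfl⟩ := hzι
    rw [extendAlong_apply hι, hι.extend_apply, hι.extend_apply, hf y hzs, add_neg_cancel]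
  · rw [extendAlong_of_notMem_range σ hzι, Function.extend_apply' _ _ _ hzι, Pi.zero_apply,
      add_zero]
  · exact fun e => (extendAlong_eq_self_iff hι hne).1 e hzι
  · exact absurd (Function.extend_apply' _ _ _ hzι) hz

end ExtendAlong


section Crossing

variable {X : Type*}

open Classical in
/-- The indicator mod 2 of `z < x`. In the disjoint union of several rows this means that `z` is in
the row of `x` and to the left of it. -/
noncomputable def leftOf [LT X] (z x : X) : ZMod 2 := if z < x then 1 else 0

/-- For distinct points of a row, or of an upper and a lower row, the parity of the number of
crossings of a string from `x` to `y` with a string from `c` to `d` between the two rows. -/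
noncomputable def crossParity [LT X] (x y c d : X) : ZMod 2 :=
  leftOf c x + leftOf c y + (leftOf d x + leftOf d y)

theorem leftOf_eq_zero [LT X] {z x : X} (h : ¬ z < x) : leftOf z x = 0 := if_neg h

theorem leftOf_congr [LT X] {Y : Type*} [LT Y] {z x : X} {z' x' : Y} (h : z < x ↔ z' < x') :
    leftOf z x = leftOf z' x' := by
  by_cases hzx : z < x <;> simp [leftOf, ← h, hzx]

theorem sum_leftOf_extendAlong {Y : Type*} [LT X] [LT Y] {ι : Y → X} {σ : Y → Y}
    (hι : ι.Injective) (hlt : ∀ a b, ι a < ι b ↔ a < b) (hout : ∀ z ∉ Set.range ι, ∀ b, ¬ z < ι b)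
    (hσ : σ.Involutive) (hne : ∀ y, σ y ≠ y) {s : Finset X}
    (hs : ∀ z ∈ s, extendAlong ι σ z ∈ s) {x : X}
    (hcross : ∀ a b, ι a ∈ s → ι b = x → crossParity b (σ b) a (σ a) = 0) :
    ∑ z ∈ s, leftOf z (extendAlong ι σ x) = ∑ z ∈ s, leftOf z x := by
  by_cases hx : x ∈ Set.range ι
  · obtain ⟨b, rfl⟩ := hx
    rw [extendAlong_apply hι, ← CharTwo.add_eq_zero, add_comm, ← Finset.sum_add_distrib]
    have hextend : ∀ z, leftOf z (ι b) + leftOf z (ι (σ b)) =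
        Function.extend ι (fun a => leftOf a b + leftOf a (σ b)) 0 z := fun z => by
      by_cases hz : z ∈ Set.range ι
      · obtain ⟨a, rfl⟩ := hz
        rw [hι.extend_apply, leftOf_congr (hlt a b), leftOf_congr (hlt a (σ b))]
      · rw [Function.extend_apply' _ _ _ hz, leftOf_eq_zero (hout z hz _),
          leftOf_eq_zero (hout z hz _), add_zero, Pi.zero_apply]
    simp only [hextend]
    refine sum_extend_eq_zero hι hσ hne hs fun a ha => ?_
    rw [eq_neg_iff_add_eq_zero, add_comm]
    exact hcross a b ha rfl
  · rw [extendAlong_of_notMem_range σ hx]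

theorem leftOf_add_leftOf [LinearOrder X] {z x : X} (h : z ≠ x) : leftOf z x + leftOf x z = 1 := by
  rcases h.lt_or_gt with h | h <;> simp [leftOf, h, h.not_gt]

theorem crossParity_comm [LinearOrder X] {x y c d : X} (hcx : c ≠ x) (hcy : c ≠ y) (hdx : d ≠ x)
    (hdy : d ≠ y) : crossParity x y c d = crossParity c d x y := by
  have h1 := leftOf_add_leftOf hcx
  have h2 := leftOf_add_leftOf hcy
  have h3 := leftOf_add_leftOf hdx
  have h4 := leftOf_add_leftOf hdy
  rw [← CharTwo.add_eq_zero, crossParity, crossParity]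
  calc _ = (leftOf c x + leftOf x c) + (leftOf c y + leftOf y c) +
        ((leftOf d x + leftOf x d) + (leftOf d y + leftOf y d)) := by ring
    _ = 0 := by rw [h1, h2, h3, h4]; decide

end Crossing

section Level

/-- The color sum of a word of (native) colors. -/
def wordSum (w : List Color) : ℤ := (w.map Color.sign).sum

/-- The level of the `i`-th letter of a word: the smaller one of the color sums of the prefixes
that end right before and right after it. -/
def rowLevel (w : List Color) (i : Fin w.length) : ℤ :=
  min (wordSum (w.take i)) (wordSum (w.take (i + 1)))

variable {u l : List Color}

/-- The level of a point, computed in its row. In a partition all of whose sectors are neutral it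
is constant on blocks, and the color distance of two blocks is the distance of their levels. -/
def level : Points u l → ℤ := Sum.elim (rowLevel u) (rowLevel l)

/-- The sign of the normalized color of a point. -/
def normSign : Points u l → ℤ :=
  Sum.elim (fun i => -(u.get i).sign) (fun j => (l.get j).sign)

/-- `r` is a pair partition with partner map `σ` in which partners have opposite normalized colors
and the same level, and in which strings at a level distance in `D` cross an even number of
times. -/
structure IsLevelPairing (D : Set ℕ) (r : Setoid (Points u l)) (σ : Points u l → Points u l) : Prop
    extends IsPairing r σ where
  sign : ∀ x, normSign (σ x) = -normSign x
  level : ∀ x, level (σ x) = level x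
  parity : ∀ x c, c ≠ x → c ≠ σ x → (TwoColored.level c - TwoColored.level x).natAbs ∈ D →
    crossParity x (σ x) c (σ c) = 0

/-- The partitions that have a level pairing for `D`. -/
def levelPartitions (D : Set ℕ) : Set ColPartition := {p | ∃ σ, IsLevelPairing D p.rel σ}

end Level

section Composition

variable {u v w : List Color}

/-- The inclusion of the upper two of three rows. -/
def upperTwo : Points u v → Fin u.length ⊕ Points v w := Sum.map id Sum.inl

/-- The inclusion of the lower two of three rows. -/
def lowerTwo : Points v w → Fin u.length ⊕ Points v w := Sum.inr

/-- The inclusion of the outer two of three rows. -/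
def outerTwo : Points u w → Fin u.length ⊕ Points v w := Sum.map id Sum.inr

theorem upperTwo_injective : (upperTwo (u := u) (v := v) (w := w)).Injective :=
  Function.injective_id.sumMap Sum.inl_injective

theorem lowerTwo_injective : (lowerTwo (u := u) (v := v) (w := w)).Injective :=
  Sum.inr_injective

theorem outerTwo_injective : (outerTwo (u := u) (v := v) (w := w)).Injective :=
  Function.injective_id.sumMap Sum.inr_injective

theorem upperTwo_lt_upperTwo (a b : Points u v) :
    upperTwo (w := w) a < upperTwo b ↔ a < b := by
  rcases a with a | a <;> rcases b with b | b <;> simp [upperTwo]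

theorem lowerTwo_lt_lowerTwo (a b : Points v w) :
    lowerTwo (u := u) a < lowerTwo b ↔ a < b :=
  Sum.inr_lt_inr_iff

theorem outerTwo_lt_outerTwo (a b : Points u w) :
    outerTwo (v := v) a < outerTwo b ↔ a < b := by
  rcases a with a | a <;> rcases b with b | b <;> simp [outerTwo]

theorem not_lt_upperTwo (z : Fin u.length ⊕ Points v w) (hz : z ∉ Set.range upperTwo)
    (b : Points u v) : ¬ z < upperTwo b := by
  rcases z with z | z | z
  · exact absurd ⟨.inl z, rfl⟩ hz
  · exact absurd ⟨.inr z, rfl⟩ hz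
  · rcases b with b | b <;> simp [upperTwo]

theorem not_lt_lowerTwo (z : Fin u.length ⊕ Points v w) (hz : z ∉ Set.range lowerTwo)
    (b : Points v w) : ¬ z < lowerTwo b := by
  rcases z with z | z
  · exact Sum.not_inl_lt_inr
  · exact absurd ⟨z, rfl⟩ hz

theorem not_lt_outerTwo (z : Fin u.length ⊕ Points v w) (hz : z ∉ Set.range outerTwo)
    (b : Points u w) : ¬ z < outerTwo b := by
  rcases z with z | z | z
  · exact absurd ⟨.inl z, rfl⟩ hz
  · rcases b with b | b <;> simp [outerTwo]
  · exact absurd ⟨.inr z, rfl⟩ hz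

theorem mem_range_upperTwo_or_lowerTwo (z : Fin u.length ⊕ Points v w) :
    z ∈ Set.range upperTwo ∨ z ∈ Set.range lowerTwo := by
  rcases z with z | z
  exacts [.inl ⟨.inl z, rfl⟩, .inr ⟨z, rfl⟩]

theorem mem_range_outerTwo_iff (z : Fin u.length ⊕ Points v w) :
    z ∈ Set.range outerTwo ↔ z ∉ Set.range upperTwo ∨ z ∉ Set.range lowerTwo := by
  rcases z with z | z | z <;> simp [upperTwo, lowerTwo, outerTwo]

/-- The equivalence relation generated on three rows by the strings of two partitions that share
the middle row. -/
noncomputable def gluedSetoid (σ : Points v w → Points v w) (σ' : Points u v → Points u v) :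
    Setoid (Fin u.length ⊕ Points v w) :=
  alternatingSetoid (extendAlong upperTwo σ') (extendAlong lowerTwo σ)

variable {r : Setoid (Points v w)} {r' : Setoid (Points u v)} {σ : Points v w → Points v w}
  {σ' : Points u v → Points u v}

theorem compRel_eq_comap_gluedSetoid (h : IsPairing r σ) (h' : IsPairing r' σ') :
    compRel r r' = (gluedSetoid σ σ').comap outerTwo := by
  refine congrArg (Setoid.comap outerTwo) (le_antisymm (Setoid.eqvGen_le ?_) (Setoid.eqvGen_le ?_))
  · rintro _ _ (⟨a, b, hab, rfl, rfl⟩ | ⟨a, b, hab, rfl, rfl⟩)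
    · rcases (h'.rel_iff a b).1 hab with rfl | rfl
      · exact Setoid.refl' _ _
      · have := alternatingSetoid_left (extendAlong upperTwo σ') (extendAlong lowerTwo σ)
          (upperTwo a)
        rwa [extendAlong_apply upperTwo_injective] at this
    · rcases (h.rel_iff a b).1 hab with rfl | rfl
      · exact Setoid.refl' _ _
      · have := alternatingSetoid_right (extendAlong upperTwo σ') (extendAlong lowerTwo σ)
          (lowerTwo a)
        rwa [extendAlong_apply lowerTwo_injective] at this
  · rintro z _ (rfl | rfl)
    · by_cases hz : z ∈ Set.range upperTwo
      · obtain ⟨a, rfl⟩ := hz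
        rw [extendAlong_apply upperTwo_injective]
        exact .rel _ _ (.inl ⟨a, σ' a, h'.rel_apply a, rfl, rfl⟩)
      · rw [extendAlong_of_notMem_range _ hz]
    · by_cases hz : z ∈ Set.range lowerTwo
      · obtain ⟨a, rfl⟩ := hz
        rw [extendAlong_apply lowerTwo_injective]
        exact .rel _ _ (.inr ⟨a, σ a, h.rel_apply a, rfl, rfl⟩)
      · rw [extendAlong_of_notMem_range _ hz]

theorem IsPairing.gluedSetoid_induction (h : IsPairing r σ) (h' : IsPairing r' σ')
    {P : Fin u.length ⊕ Points v w → Prop}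
    (hupper : ∀ z, P z → P (extendAlong upperTwo σ' z))
    (hlower : ∀ z, P z → P (extendAlong lowerTwo σ z)) {x y : Fin u.length ⊕ Points v w}
    (hxy : gluedSetoid σ σ' x y) (hx : P x) : P y :=
  alternatingSetoid_induction (extendAlong_involutive upperTwo_injective h'.involutive)
    (extendAlong_involutive lowerTwo_injective h.involutive) hupper hlower hxy hx

theorem IsPairing.exists_isPairing_compRel (h : IsPairing r σ) (h' : IsPairing r' σ') :
    ∃ τ, IsPairing (compRel r r') τ := by
  refine exists_isPairing_of_existsUnique fun x => ?_
  have hfix : ∀ z : Fin u.length ⊕ Points v w, z ∈ Set.range outerTwo ↔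
      extendAlong upperTwo σ' z = z ∨ extendAlong lowerTwo σ z = z := fun z => by
    rw [mem_range_outerTwo_iff, extendAlong_eq_self_iff upperTwo_injective h'.ne,
      extendAlong_eq_self_iff lowerTwo_injective h.ne]
  have hnot : ∀ z : Fin u.length ⊕ Points v w,
      extendAlong upperTwo σ' z = z → extendAlong lowerTwo σ z ≠ z := fun z => by
    rw [Ne, extendAlong_eq_self_iff upperTwo_injective h'.ne,
      extendAlong_eq_self_iff lowerTwo_injective h.ne, not_not]
    exact (mem_range_upperTwo_or_lowerTwo z).resolve_left
  obtain ⟨_, ⟨hne, hrel, hy⟩, huniq⟩ :=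
    existsUnique_fixed (extendAlong_involutive upperTwo_injective h'.involutive)
      (extendAlong_involutive lowerTwo_injective h.involutive) hnot ((hfix (outerTwo x)).1 ⟨x, rfl⟩)
  obtain ⟨y, rfl⟩ := (hfix _).2 hy
  rw [compRel_eq_comap_gluedSetoid h h']
  exact ⟨y, ⟨fun hyx => hne (hyx ▸ rfl), hrel⟩, fun z hz => outerTwo_injective
    (huniq _ ⟨outerTwo_injective.ne hz.1, hz.2, (hfix _).1 ⟨z, rfl⟩⟩)⟩

/-- The level of a point of three rows. -/
def threeRowLevel : Fin u.length ⊕ Points v w → ℤ := Sum.elim (rowLevel u) level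

theorem threeRowLevel_upperTwo (x : Points u v) :
    threeRowLevel (w := w) (upperTwo x) = level x := by
  rcases x with x | x <;> rfl

theorem threeRowLevel_lowerTwo (x : Points v w) :
    threeRowLevel (u := u) (lowerTwo x) = level x := rfl

theorem threeRowLevel_outerTwo (x : Points u w) :
    threeRowLevel (v := v) (outerTwo x) = level x := by
  rcases x with x | x <;> rfl

theorem extend_normSign_outerTwo (x : Points u w) :
    Function.extend upperTwo normSign 0 (outerTwo (v := v) x) +
      Function.extend lowerTwo normSign 0 (outerTwo (v := v) x) = normSign x := by
  rcases x with i | j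
  · have hlower : ¬∃ y : Points v w, lowerTwo y = outerTwo (u := u) (.inl i) := by
      rintro ⟨_, ⟨⟩⟩
    rw [Function.extend_apply' _ _ _ hlower, Pi.zero_apply, add_zero]
    exact upperTwo_injective.extend_apply normSign 0 (.inl i)
  · have hupper : ¬∃ y : Points u v, upperTwo y = outerTwo (w := w) (.inr j) := by
      simp [upperTwo, outerTwo]
    rw [Function.extend_apply' _ _ _ hupper, Pi.zero_apply, zero_add]
    exact lowerTwo_injective.extend_apply normSign 0 (.inr j)

theorem extend_normSign_of_notMem_range_outerTwo (z : Fin u.length ⊕ Points v w)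
    (hz : z ∉ Set.range outerTwo) :
    Function.extend upperTwo normSign 0 z + Function.extend lowerTwo normSign 0 z = 0 := by
  rcases z with i | k | j
  · exact absurd ⟨.inl i, rfl⟩ hz
  · have hupper := upperTwo_injective (w := w).extend_apply (normSign (u := u)) 0 (.inr k)
    have hlower := lowerTwo_injective (u := u).extend_apply (normSign (l := w)) 0 (.inl k)
    exact (congrArg₂ (· + ·) hupper hlower).trans (add_neg_cancel _)
  · exact absurd ⟨.inr j, rfl⟩ hz

theorem IsLevelPairing.sum_leftOf_extendAlong {a b : List Color} {q : Setoid (Points a b)}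
    {ρ : Points a b → Points a b} {D : Set ℕ} (hρ : IsLevelPairing D q ρ)
    {ι : Points a b → Fin u.length ⊕ Points v w} (hι : ι.Injective)
    (hlt : ∀ y z, ι y < ι z ↔ y < z) (hout : ∀ z ∉ Set.range ι, ∀ y, ¬ z < ι y)
    (hlevel : ∀ y, threeRowLevel (ι y) = TwoColored.level y)
    {R : Setoid (Fin u.length ⊕ Points v w)} (hR : ∀ z, R z (extendAlong ι ρ z))
    (hRlevel : ∀ {y z}, R y z → threeRowLevel z = threeRowLevel y)
    {s : Finset (Fin u.length ⊕ Points v w)} {c x : Fin u.length ⊕ Points v w}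
    (hs : ∀ z, z ∈ s ↔ R c z) (hcx : ¬ R c x)
    (hD : (threeRowLevel c - threeRowLevel x).natAbs ∈ D) :
    ∑ z ∈ s, leftOf z (extendAlong ι ρ x) = ∑ z ∈ s, leftOf z x := by
  refine TwoColored.sum_leftOf_extendAlong hι hlt hout hρ.involutive hρ.ne
    (fun z hz => (hs _).2 (R.trans' ((hs z).1 hz) (hR z))) ?_
  rintro y z hy rfl
  rw [hs] at hy
  refine hρ.parity z y ?_ ?_ ?_
  · rintro rfl
    exact hcx hy
  · rintro rfl
    refine hcx (R.trans' hy (R.symm' ?_))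
    rw [← extendAlong_apply hι]
    exact hR _
  · rwa [← hlevel, ← hlevel, hRlevel hy]

section LevelPairing

variable {D : Set ℕ} {τ : Points u w → Points u w} (h : IsLevelPairing D r σ)
  (h' : IsLevelPairing D r' σ')
include h h'

theorem IsLevelPairing.threeRowLevel_eq {x y : Fin u.length ⊕ Points v w}
    (hxy : gluedSetoid σ σ' x y) : threeRowLevel y = threeRowLevel x := by
  refine h.toIsPairing.gluedSetoid_induction h'.toIsPairing
    (P := fun y => threeRowLevel y = threeRowLevel x) (fun z hz => ?_) (fun z hz => ?_) hxy rfl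
  · rw [← hz]
    exact comp_extendAlong_eq upperTwo_injective
      (fun a => by simp only [threeRowLevel_upperTwo, h'.level]) z
  · rw [← hz]
    exact comp_extendAlong_eq lowerTwo_injective
      (fun a => by simp only [threeRowLevel_lowerTwo, h.level]) z

theorem IsLevelPairing.level_compRel (hτ : IsPairing (compRel r r') τ) (x : Points u w) :
    TwoColored.level (τ x) = TwoColored.level x := by
  rw [compRel_eq_comap_gluedSetoid h.toIsPairing h'.toIsPairing] at hτ
  rw [← threeRowLevel_outerTwo (v := v), ← threeRowLevel_outerTwo (v := v)]
  exact h.threeRowLevel_eq h' (hτ.rel_apply x)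

/-- In the sum of the normalized signs of both partitions over a class of `gluedSetoid`, the two
normalized signs of a point of the middle row cancel. -/
theorem IsLevelPairing.normSign_compRel (hτ : IsPairing (compRel r r') τ) (x : Points u w) :
    normSign (τ x) = -normSign x := by
  classical
  rw [compRel_eq_comap_gluedSetoid h.toIsPairing h'.toIsPairing] at hτ
  set s : Finset (Fin u.length ⊕ Points v w) := {z | gluedSetoid σ σ' (outerTwo x) z} with hs
  have hmem : ∀ z, z ∈ s ↔ gluedSetoid σ σ' (outerTwo x) z := by simp [hs]
  have hupper : ∑ z ∈ s, Function.extend upperTwo normSign 0 z = 0 :=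
    sum_extend_eq_zero upperTwo_injective h'.involutive h'.ne
      (fun z hz => (hmem _).2 (Setoid.trans' _ ((hmem z).1 hz) (alternatingSetoid_left _ _ z)))
      fun y _ => h'.sign y
  have hlower : ∑ z ∈ s, Function.extend lowerTwo normSign 0 z = 0 :=
    sum_extend_eq_zero lowerTwo_injective h.involutive h.ne
      (fun z hz => (hmem _).2 (Setoid.trans' _ ((hmem z).1 hz) (alternatingSetoid_right _ _ z)))
      fun y _ => h.sign y
  have hsum := hτ.sum_class_eq outerTwo_injective extend_normSign_of_notMem_range_outerTwo hmem
  rw [extend_normSign_outerTwo, extend_normSign_outerTwo, Finset.sum_add_distrib, hupper,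
    hlower] at hsum
  linarith

theorem IsLevelPairing.sum_leftOf_eq_of_gluedSetoid {s : Finset (Fin u.length ⊕ Points v w)}
    {c x y : Fin u.length ⊕ Points v w} (hs : ∀ z, z ∈ s ↔ gluedSetoid σ σ' c z)
    (hcx : ¬ gluedSetoid σ σ' c x) (hD : (threeRowLevel c - threeRowLevel x).natAbs ∈ D)
    (hxy : gluedSetoid σ σ' x y) : ∑ z ∈ s, leftOf z y = ∑ z ∈ s, leftOf z x := by
  have hcz : ∀ {z}, gluedSetoid σ σ' x z → ¬ gluedSetoid σ σ' c z :=
    fun hxz hcz => hcx (Setoid.trans' _ hcz (Setoid.symm' _ hxz))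
  have hDz : ∀ {z}, gluedSetoid σ σ' x z →
      (threeRowLevel c - threeRowLevel z).natAbs ∈ D := fun hxz => by
    rwa [h.threeRowLevel_eq h' hxz]
  refine (h.toIsPairing.gluedSetoid_induction h'.toIsPairing (P := fun y => gluedSetoid σ σ' x y ∧
    ∑ z ∈ s, leftOf z y = ∑ z ∈ s, leftOf z x) ?_ ?_ hxy ⟨Setoid.refl' _ _, rfl⟩).2
  · rintro y ⟨hxy, hsum⟩
    have hstep := alternatingSetoid_left (extendAlong upperTwo σ') (extendAlong lowerTwo σ)
    exact ⟨Setoid.trans' _ hxy (hstep y), hsum ▸ h'.sum_leftOf_extendAlong upperTwo_injective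
      upperTwo_lt_upperTwo not_lt_upperTwo threeRowLevel_upperTwo hstep (h.threeRowLevel_eq h')
      hs (hcz hxy) (hDz hxy)⟩
  · rintro y ⟨hxy, hsum⟩
    have hstep := alternatingSetoid_right (extendAlong upperTwo σ') (extendAlong lowerTwo σ)
    exact ⟨Setoid.trans' _ hxy (hstep y), hsum ▸ h.sum_leftOf_extendAlong lowerTwo_injective
      lowerTwo_lt_lowerTwo not_lt_lowerTwo threeRowLevel_lowerTwo hstep (h.threeRowLevel_eq h')
      hs (hcz hxy) (hDz hxy)⟩

theorem IsLevelPairing.crossParity_compRel (hτ : IsPairing (compRel r r') τ) {x c : Points u w}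
    (hcx : c ≠ x) (hcτ : c ≠ τ x)
    (hD : (TwoColored.level c - TwoColored.level x).natAbs ∈ D) :
    crossParity x (τ x) c (τ c) = 0 := by
  classical
  rw [compRel_eq_comap_gluedSetoid h.toIsPairing h'.toIsPairing] at hτ
  set s : Finset (Fin u.length ⊕ Points v w) := {z | gluedSetoid σ σ' (outerTwo c) z} with hs
  have hmem : ∀ z, z ∈ s ↔ gluedSetoid σ σ' (outerTwo c) z := by simp [hs]
  have hclass : ∀ y : Points u w,
      ∑ z ∈ s, leftOf z (outerTwo y) = leftOf c y + leftOf (τ c) y := fun y => by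
    rw [hτ.sum_class_eq outerTwo_injective
      (fun z hz => leftOf_eq_zero (not_lt_outerTwo z hz y)) hmem,
      leftOf_congr (outerTwo_lt_outerTwo _ _), leftOf_congr (outerTwo_lt_outerTwo _ _)]
  have hcx' : ¬ gluedSetoid σ σ' (outerTwo c) (outerTwo x) := fun hrel =>
    ((hτ.rel_iff x c).1 (Setoid.symm' _ hrel)).elim hcx hcτ
  have hsum := h.sum_leftOf_eq_of_gluedSetoid h' hmem hcx'
    (by rwa [threeRowLevel_outerTwo, threeRowLevel_outerTwo]) (hτ.rel_apply x)
  rwa [hclass, hclass, ← CharTwo.add_eq_zero, add_comm, add_add_add_comm] at hsum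

theorem IsLevelPairing.exists_isLevelPairing_compRel :
    ∃ τ, IsLevelPairing D (compRel r r') τ := by
  obtain ⟨τ, hτ⟩ := h.toIsPairing.exists_isPairing_compRel h'.toIsPairing
  exact ⟨τ, hτ, h.normSign_compRel h' hτ, h.level_compRel h' hτ,
    fun _ _ => h.crossParity_compRel h' hτ⟩

end LevelPairing

end Composition


section ColorSum

theorem sum_sign_lt (w : List Color) (k : ℕ) :
    ∑ i : Fin w.length with i.val < k, (w.get i).sign = wordSum (w.take k) := by
  simp only [wordSum, Finset.sum_filter]
  induction w generalizing k with
  | nil => simp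
  | cons c w ih =>
    cases k with
    | zero => simp
    | succ k =>
      rw [List.take_succ_cons, List.map_cons, List.sum_cons, ← ih k]
      refine (Fin.sum_univ_succ _).trans ?_
      simp only [Fin.val_succ, Nat.add_lt_add_iff_right]
      rfl

theorem wordSum_take_succ (w : List Color) (i : Fin w.length) :
    wordSum (w.take (i + 1)) = wordSum (w.take i) + (w.get i).sign := by
  rw [List.take_succ_eq_append_getElem i.2]
  simp only [wordSum, List.map_append, List.sum_append, List.map_cons, List.map_nil,
    List.sum_singleton, List.get_eq_getElem]

variable {u l : List Color}

theorem sum_normSign : ∑ x : Points u l, normSign x = wordSum l - wordSum u := by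
  have h : ∀ w : List Color, ∑ i : Fin w.length, (w.get i).sign = wordSum w := fun w => by
    simpa using sum_sign_lt w w.length
  rw [Fintype.sum_sum_type]
  simp only [normSign, Sum.elim_inl, Sum.elim_inr, Finset.sum_neg_distrib, h]
  ring

theorem normSign_eq_one_or_neg_one (x : Points u l) : normSign x = 1 ∨ normSign x = -1 := by
  rcases x with i | j
  · change -(u.get i).sign = 1 ∨ -(u.get i).sign = -1
    cases u.get i <;> decide
  · change (l.get j).sign = 1 ∨ (l.get j).sign = -1
    cases l.get j <;> decide

theorem IsLevelPairing.wordSum_eq {D : Set ℕ} {r : Setoid (Points u l)}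
    {σ : Points u l → Points u l} (h : IsLevelPairing D r σ) : wordSum u = wordSum l := by
  have := sum_normSign.symm.trans (h.sum_eq_zero h.sign)
  omega

end ColorSum

section Crossing

theorem crossParity_eq_zero_iff_lt {X : Type*} [LT X] {x y c d : X} :
    crossParity x y c d = 0 ↔ ((c < x ↔ c < y) ↔ (d < x ↔ d < y)) := by
  by_cases h1 : c < x <;> by_cases h2 : c < y <;> by_cases h3 : d < x <;> by_cases h4 : d < y <;>
    simp [crossParity, leftOf, h1, h2, h3, h4, CharTwo.add_self_eq_zero]

/-- The indicator mod 2 of the upper row. -/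
def upperParity {u l : List Color} : Points u l → ZMod 2 := Sum.elim 1 0

namespace ColPartition

variable {p : ColPartition}

theorem pos_inl (i : Fin p.upper.length) :
    p.pos (.inl i) = p.lower.length + (p.upper.length - 1 - i) := rfl

theorem pos_inr (j : Fin p.lower.length) : p.pos (.inr j) = j := rfl

theorem pos_injective : p.pos.Injective := by
  rintro (i | i) (j | j) h <;> simp only [pos_inl, pos_inr] at h
  · exact congrArg Sum.inl (Fin.ext (by omega))
  · omega
  · omega
  · exact congrArg Sum.inr (Fin.ext h)

theorem leftOf_pos {z x : p.Pt} (h : z ≠ x) :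
    leftOf (p.pos z) (p.pos x) = leftOf z x + upperParity x := by
  have hpos := pos_injective.ne h
  rcases z with i | i <;> rcases x with j | j <;> simp only [pos_inl, pos_inr] at hpos ⊢
  · have hrev : leftOf (p.pos (.inl i)) (p.pos (.inl j)) = leftOf j i :=
      leftOf_congr (by simp only [pos_inl]; omega)
    have hlt : leftOf (Sum.inl i : p.Pt) (.inl j) = leftOf i j := leftOf_congr Sum.inl_lt_inl_iff
    rw [hlt, upperParity, Sum.elim_inl, Pi.one_apply,
      ← leftOf_add_leftOf (fun hij => h (congrArg Sum.inl hij)), ← add_assoc,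
      CharTwo.add_self_eq_zero, zero_add]
    exact hrev
  · rw [leftOf_eq_zero (by omega), leftOf_eq_zero Sum.not_inl_lt_inr]
    rfl
  · rw [leftOf, if_pos (by omega), leftOf_eq_zero Sum.not_inr_lt_inl]
    rfl
  · simp [leftOf, upperParity]

theorem crossParity_pos {x y c d : p.Pt} (hcx : c ≠ x) (hcy : c ≠ y) (hdx : d ≠ x) (hdy : d ≠ y) :
    crossParity (p.pos x) (p.pos y) (p.pos c) (p.pos d) = crossParity x y c d := by
  rw [crossParity, leftOf_pos hcx, leftOf_pos hcy, leftOf_pos hdx, leftOf_pos hdy, crossParity]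
  linear_combination CharTwo.add_self_eq_zero (upperParity x + upperParity y)

theorem Between.ne {a b c : p.Pt} (h : p.Between a b c) : a ≠ c := by
  rintro rfl
  unfold Between at h
  omega

theorem Between.not_swap {a b c : p.Pt} (h : p.Between a b c) : ¬ p.Between c b a := by
  unfold Between at *
  omega

theorem cross_pair_iff {x y c d : p.Pt} :
    p.Cross {x, y} {c, d} ↔
      p.Between x c y ∧ p.Between y d x ∨ p.Between x d y ∧ p.Between y c x := by
  constructor
  · rintro ⟨a, rfl | rfl, b, rfl | rfl, e, rfl | rfl, f, rfl | rfl, h, h'⟩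
    all_goals first
      | exact absurd rfl h.ne
      | exact absurd h' h.not_swap
      | exact .inl ⟨h, h'⟩
      | exact .inl ⟨h', h⟩
      | exact .inr ⟨h, h'⟩
      | exact .inr ⟨h', h⟩
  · rintro (⟨h, h'⟩ | ⟨h, h'⟩)
    · exact ⟨x, .inl rfl, y, .inr rfl, c, .inl rfl, d, .inr rfl, h, h'⟩
    · exact ⟨x, .inl rfl, y, .inr rfl, d, .inr rfl, c, .inl rfl, h, h'⟩

theorem crossParity_eq_zero_iff {x y c d : p.Pt} (hxy : x ≠ y) (hcx : c ≠ x)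
    (hcy : c ≠ y) (hdx : d ≠ x) (hdy : d ≠ y) :
    crossParity x y c d = 0 ↔ ¬ p.Cross {x, y} {c, d} := by
  rw [← crossParity_pos hcx hcy hdx hdy, crossParity_eq_zero_iff_lt, cross_pair_iff]
  rw [← pos_injective.ne_iff] at hxy hcx hcy hdx hdy
  unfold Between
  omega

theorem not_cross_self (x y : p.Pt) : ¬ p.Cross {x, y} {x, y} := by
  rw [cross_pair_iff]
  unfold Between
  omega

end ColPartition

theorem crossParity_points_comm {u l : List Color} {x y c d : Points u l} (hcx : c ≠ x)
    (hcy : c ≠ y) (hdx : d ≠ x) (hdy : d ≠ y) : crossParity x y c d = crossParity c d x y := by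
  have hpos := ColPartition.pos_injective (p := ⟨u, l, ⊤⟩)
  rw [← ColPartition.crossParity_pos (p := ⟨u, l, ⊤⟩) hcx hcy hdx hdy,
    ← ColPartition.crossParity_pos (p := ⟨u, l, ⊤⟩) hcx.symm hdx.symm hcy.symm hdy.symm,
    crossParity_comm (hpos.ne hcx) (hpos.ne hcy) (hpos.ne hdx) (hpos.ne hdy)]

end Crossing


section Tensor

variable {u u' l l' : List Color}

/-- The points of a tensor product as the disjoint union of the points of the factors, the inverse
of `tensorSplit`. -/
def tensorEquiv : Points u l ⊕ Points u' l' ≃ Points (u ++ u') (l ++ l') :=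
  (Equiv.sumSumSumComm _ _ _ _).trans <| Equiv.sumCongr
    (finSumFinEquiv.trans (finCongr List.length_append.symm))
    (finSumFinEquiv.trans (finCongr List.length_append.symm))

theorem tensorSplit_eq : tensorSplit u u' l l' = tensorEquiv.symm := by
  funext z
  obtain ⟨x, rfl⟩ := tensorEquiv.surjective z
  rcases x with (i | j) | (i | j) <;> simp [tensorSplit, tensorEquiv]

theorem rowLevel_append_castAdd (i : Fin u.length) :
    rowLevel (u ++ u') (Fin.cast List.length_append.symm (Fin.castAdd _ i)) = rowLevel u i := by
  simp [rowLevel, List.take_append_of_le_length i.2.le,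
    List.take_append_of_le_length (Nat.succ_le_of_lt i.2)]

theorem rowLevel_append_natAdd (i : Fin u'.length) :
    rowLevel (u ++ u') (Fin.cast List.length_append.symm (Fin.natAdd _ i)) =
      wordSum u + rowLevel u' i := by
  simp [rowLevel, wordSum, add_assoc, List.take_length_add_append, min_add_add_left]

theorem level_tensorEquiv_inl (x : Points u l) :
    level (tensorEquiv (u' := u') (l' := l') (.inl x)) = level x := by
  rcases x with i | j
  exacts [rowLevel_append_castAdd i, rowLevel_append_castAdd j]

theorem level_tensorEquiv_inr (h : wordSum u = wordSum l) (x : Points u' l') :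
    level (tensorEquiv (u := u) (l := l) (.inr x)) = wordSum u + level x := by
  rcases x with i | j
  · exact rowLevel_append_natAdd i
  · rw [h]
    exact rowLevel_append_natAdd j

theorem normSign_tensorEquiv (x : Points u l ⊕ Points u' l') :
    normSign (tensorEquiv x) = Sum.elim normSign normSign x := by
  rcases x with (i | j) | (i | j) <;> simp [normSign, tensorEquiv]

theorem tensorEquiv_inl_lt_inl (x y : Points u l) :
    tensorEquiv (u' := u') (l' := l') (.inl x) < tensorEquiv (.inl y) ↔ x < y := by
  rcases x with i | j <;> rcases y with i' | j' <;>
    simp [tensorEquiv, (Fin.strictMono_castAdd _).lt_iff_lt]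

theorem tensorEquiv_inr_lt_inr (x y : Points u' l') :
    tensorEquiv (u := u) (l := l) (.inr x) < tensorEquiv (.inr y) ↔ x < y := by
  rcases x with i | j <;> rcases y with i' | j' <;> simp [tensorEquiv]

theorem not_tensorEquiv_inr_lt_inl (x : Points u' l') (y : Points u l) :
    ¬ tensorEquiv (.inr x) < tensorEquiv (.inl y) := by
  rcases x with i | j <;> rcases y with i' | j' <;>
    simp [tensorEquiv, Fin.le_def, Nat.le_add_right_of_le]

theorem crossParity_tensorEquiv_inl_inr (x y : Points u l) (c d : Points u' l') :
    crossParity (tensorEquiv (.inl x)) (tensorEquiv (.inl y)) (tensorEquiv (.inr c))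
      (tensorEquiv (.inr d)) = 0 := by
  simp only [crossParity, leftOf_eq_zero (not_tensorEquiv_inr_lt_inl _ _), add_zero]

variable {D : Set ℕ} {r : Setoid (Points u l)} {r' : Setoid (Points u' l')}
  {σ : Points u l → Points u l} {σ' : Points u' l' → Points u' l'}

theorem IsLevelPairing.tensor (h : IsLevelPairing D r σ) (h' : IsLevelPairing D r' σ') :
    IsLevelPairing D ((sumSetoid r r').comap (tensorSplit u u' l l'))
      (tensorEquiv ∘ Sum.map σ σ' ∘ tensorEquiv.symm) where
  toIsPairing := by
    rw [tensorSplit_eq]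
    exact (h.toIsPairing.sumSetoid h'.toIsPairing).comap_equiv tensorEquiv.symm
  sign x := by
    obtain ⟨x | x, rfl⟩ := tensorEquiv.surjective x <;>
      simp [normSign_tensorEquiv, h.sign, h'.sign]
  level x := by
    obtain ⟨x | x, rfl⟩ := tensorEquiv.surjective x <;>
      simp [level_tensorEquiv_inl, level_tensorEquiv_inr h.wordSum_eq, h.level, h'.level]
  parity x c := by
    obtain ⟨x, rfl⟩ := tensorEquiv.surjective x
    obtain ⟨c, rfl⟩ := tensorEquiv.surjective c
    simp only [Function.comp_apply, Equiv.symm_apply_apply, ne_eq, tensorEquiv.apply_eq_iff_eq]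
    rcases x with x | x <;> rcases c with c | c
    · simp only [Sum.map_inl, Sum.inl.injEq, level_tensorEquiv_inl, crossParity,
        leftOf_congr (tensorEquiv_inl_lt_inl _ _)]
      exact h.parity x c
    · exact fun _ _ _ => crossParity_tensorEquiv_inl_inr _ _ _ _
    · intro _ _ _
      rw [crossParity_points_comm]
      · exact crossParity_tensorEquiv_inl_inr _ _ _ _
      all_goals simp
    · simp only [Sum.map_inr, Sum.inr.injEq, level_tensorEquiv_inr h.wordSum_eq, crossParity,
        leftOf_congr (tensorEquiv_inr_lt_inr _ _), add_sub_add_left_eq_sub]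
      exact h'.parity x c

end Tensor

section Involution

variable {u l : List Color}

theorem level_swap (x : Points u l) : level x.swap = level x := by
  rcases x with i | j <;> rfl

theorem normSign_swap (x : Points u l) : normSign x.swap = -normSign x := by
  rcases x with i | j <;> simp [normSign]

theorem crossParity_swap (x y c d : Points u l) :
    crossParity x.swap y.swap c.swap d.swap = crossParity x y c d := by
  simp only [crossParity, leftOf_congr Sum.swap_lt_swap_iff]

theorem IsLevelPairing.involution {D : Set ℕ} {r : Setoid (Points u l)}
    {σ : Points u l → Points u l} (h : IsLevelPairing D r σ) :
    IsLevelPairing D (r.comap (Sum.swap : Points l u → Points u l))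
      (Sum.swap ∘ σ ∘ Sum.swap) where
  toIsPairing := h.comap_equiv (Equiv.sumComm _ _)
  sign x := by
    rw [Function.comp_apply, normSign_swap, Function.comp_apply, h.sign, normSign_swap, neg_neg]
  level x := by
    rw [Function.comp_apply, level_swap, Function.comp_apply, h.level, level_swap]
  parity x c hcx hcσ hD := by
    rw [← crossParity_swap]
    simp only [Function.comp_apply, Sum.swap_swap]
    refine h.parity x.swap c.swap (Sum.swap_leftInverse.injective.ne hcx) (fun he => hcσ ?_) ?_
    · rw [← Sum.swap_swap c, he, Function.comp_apply, Function.comp_apply]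
    · rwa [level_swap, level_swap]

end Involution

theorem isLevelPairing_top {u l : List Color} {σ : Points u l → Points u l} (D : Set ℕ)
    (hne : ∀ x, σ x ≠ x) (hall : ∀ x y, y = x ∨ y = σ x)
    (hsign : ∀ x, normSign (σ x) = -normSign x) (hlevel : ∀ x, level (σ x) = level x) :
    IsLevelPairing D ⊤ σ where
  ne := hne
  rel_iff x y := iff_of_true trivial (hall x y)
  sign := hsign
  level := hlevel
  parity x c hcx hcσ := ((hall x c).elim hcx hcσ).elim

theorem isCategory_levelPartitions (D : Set ℕ) : IsCategory (levelPartitions D) where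
  tensor_mem := fun _ _ ⟨_, h⟩ ⟨_, h'⟩ => ⟨_, h.tensor h'⟩
  involution_mem := fun _ ⟨_, h⟩ => ⟨_, h.involution⟩
  comp_mem := fun _ _ _ _ _ ⟨_, h⟩ ⟨_, h'⟩ => h.exists_isLevelPairing_compRel h'
  id_white_mem :=
    ⟨Sum.swap, isLevelPairing_top D (by decide) (by decide) (by decide) (by decide)⟩
  id_black_mem :=
    ⟨Sum.swap, isLevelPairing_top D (by decide) (by decide) (by decide) (by decide)⟩
  pair_black_white_mem :=
    ⟨Sum.map id Fin.rev, isLevelPairing_top D (by decide) (by decide) (by decide) (by decide)⟩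
  pair_white_black_mem :=
    ⟨Sum.map id Fin.rev, isLevelPairing_top D (by decide) (by decide) (by decide) (by decide)⟩

namespace ColPartition

variable {p : ColPartition}

section ColorSum

theorem sign_normColor (x : p.Pt) : (p.normColor x).sign = normSign x := by
  have sign_inv : ∀ c : Color, c.inv.sign = -c.sign := by rintro (_ | _) <;> rfl
  rcases x with i | j
  exacts [sign_inv _, rfl]

theorem normColor_eq_iff {x y : p.Pt} :
    p.normColor x = p.normColor y ↔ normSign x = normSign y := by
  have sign_injective : Color.sign.Injective := by rintro (_ | _) (_ | _) h <;> cases h <;> rfl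
  rw [← sign_normColor, ← sign_normColor, sign_injective.eq_iff]

theorem colorSum_eq_sum_indicator (S : Set p.Pt) : p.colorSum S = ∑ z, S.indicator normSign z := by
  simp only [colorSum, sign_normColor]

theorem colorSum_univ : p.colorSum Set.univ = ∑ z : p.Pt, normSign z := by
  rw [colorSum_eq_sum_indicator, Set.indicator_univ]

theorem colorSum_insert {S : Set p.Pt} {x : p.Pt} (h : x ∉ S) :
    p.colorSum (insert x S) = normSign x + p.colorSum S := by
  simp only [colorSum_eq_sum_indicator]
  rw [Set.insert_eq, Set.indicator_union_of_disjoint (Set.disjoint_singleton_left.2 h),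
    Finset.sum_add_distrib]
  simp [Set.indicator_apply]

theorem colorSum_pair {x y : p.Pt} (h : x ≠ y) :
    p.colorSum {x, y} = normSign x + normSign y := by
  rw [colorSum_insert (mt Set.mem_singleton_iff.1 h), colorSum_eq_sum_indicator]
  simp [Set.indicator_apply]

end ColorSum

section Height

/-- The color sum of the points up to and including `x`, when the points are enumerated along the
orientation, starting with the lower row. -/
noncomputable def height (x : p.Pt) : ℤ := ∑ z with p.pos z ≤ p.pos x, normSign z

theorem colorSum_halfOpenInterval (hp : ∑ z : p.Pt, normSign z = 0) (a b : p.Pt) :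
    p.colorSum (p.halfOpenInterval a b) = height b - height a := by
  have hindicator : ∀ z, (p.halfOpenInterval a b).indicator normSign z =
      (if p.pos z ≤ p.pos b then normSign z else 0) - (if p.pos z ≤ p.pos a then normSign z else 0)
        + (if p.pos b < p.pos a then normSign z else 0) := fun z => by
    simp only [Set.indicator_apply, halfOpenInterval, Between, Set.mem_ofPred_eq, ne_eq,
      ← pos_injective.eq_iff]
    split_ifs <;> omega
  have hwrap : ∑ z : p.Pt, (if p.pos b < p.pos a then normSign z else 0) = 0 := by
    split_ifs
    exacts [hp, Finset.sum_const_zero]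
  simp only [colorSum_eq_sum_indicator, hindicator, Finset.sum_add_distrib, Finset.sum_sub_distrib,
    hwrap, add_zero, height, Finset.sum_filter]

theorem height_inr (j : Fin p.lower.length) :
    height (.inr j : p.Pt) = wordSum (p.lower.take (j + 1)) := by
  rw [← sum_sign_lt, height, Finset.sum_filter, Finset.sum_filter, Fintype.sum_sum_type,
    Finset.sum_eq_zero fun i _ => if_neg (by simp only [pos_inl, pos_inr]; omega), zero_add]
  simp only [pos_inr, Nat.lt_succ_iff]
  rfl

theorem height_inl (hp : ∑ z : p.Pt, normSign z = 0) (i : Fin p.upper.length) :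
    height (.inl i : p.Pt) = wordSum (p.upper.take i) := by
  have hafter : ∑ z with ¬ p.pos z ≤ p.pos (.inl i), normSign z = -wordSum (p.upper.take i) := by
    rw [← sum_sign_lt, Finset.sum_filter, Finset.sum_filter, Fintype.sum_sum_type,
      Finset.sum_eq_zero (s := (Finset.univ : Finset (Fin p.lower.length)))
        fun j _ => if_neg (by simp only [pos_inl, pos_inr]; omega), add_zero,
      ← Finset.sum_neg_distrib]
    refine Finset.sum_congr rfl fun k _ => ?_
    have hlt : ¬ p.pos (.inl k) ≤ p.pos (.inl i) ↔ k.val < i.val := by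
      simp only [pos_inl]
      omega
    rw [if_congr hlt rfl rfl, apply_ite Neg.neg, neg_zero]
    rfl
  have hsplit := Finset.sum_filter_add_sum_filter_not Finset.univ
    (fun z => p.pos z ≤ p.pos (.inl i)) normSign
  rw [hp, hafter, ← sub_eq_add_neg, sub_eq_zero] at hsplit
  exact hsplit

theorem level_eq_min (hp : ∑ z : p.Pt, normSign z = 0) (x : p.Pt) :
    level x = min (height x) (height x - normSign x) := by
  rcases x with i | j
  · rw [height_inl hp]
    change min _ _ = min _ (_ - -(p.upper.get i).sign)
    rw [wordSum_take_succ, sub_neg_eq_add]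
  · rw [height_inr]
    change min _ _ = min _ (_ - (p.lower.get j).sign)
    rw [wordSum_take_succ, add_sub_cancel_right, min_comm]

theorem colorSum_closedInterval (hp : ∑ z : p.Pt, normSign z = 0) {a b : p.Pt}
    (hsign : normSign b = -normSign a) :
    p.colorSum (p.closedInterval a b) = level b - level a := by
  have hinsert : p.closedInterval a b = insert a (p.halfOpenInterval a b) := by
    ext z
    simp only [closedInterval, halfOpenInterval, Set.mem_ofPred_eq, Set.mem_insert_iff]
    tauto
  rw [hinsert, colorSum_insert (fun h => h.1 rfl), colorSum_halfOpenInterval hp, level_eq_min hp,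
    level_eq_min hp]
  rcases normSign_eq_one_or_neg_one a with h | h <;> rw [hsign, h] <;> omega

theorem signedDist_eq (hp : ∑ z : p.Pt, normSign z = 0) (a b : p.Pt) :
    p.signedDist a b = level b - level a := by
  have hhalf := colorSum_halfOpenInterval hp a b
  rw [level_eq_min hp, level_eq_min hp, signedDist]
  split_ifs with hcolor
  · rw [normColor_eq_iff] at hcolor
    omega
  · have hne : b ≠ a := fun h => hcolor (h ▸ rfl)
    have hinsert : p.halfOpenInterval a b = insert b (p.openInterval a b) := by
      ext z
      simp only [halfOpenInterval, openInterval, Between, Set.mem_ofPred_eq, Set.mem_insert_iff,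
        ne_eq, ← pos_injective.eq_iff] at hne ⊢
      omega
    have hnotMem : b ∉ p.openInterval a b := by
      simp only [openInterval, Between, Set.mem_ofPred_eq]
      omega
    rw [hinsert, colorSum_insert hnotMem] at hhalf
    rw [normColor_eq_iff] at hcolor
    rcases normSign_eq_one_or_neg_one a with ha | ha <;>
      rcases normSign_eq_one_or_neg_one b with hb | hb <;> omega

end Height

section Membership

variable {σ : p.Pt → p.Pt}

theorem mem_pairNeutral_iff (h : IsPairing p.rel σ) :
    p ∈ pairNeutral ↔ ∀ x, normSign (σ x) = -normSign x := by
  constructor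
  · intro hp x
    have := (hp _ (h.pair_mem_classes x)).2
    rw [colorSum_pair (h.ne x).symm] at this
    omega
  · intro hsign B hB
    obtain ⟨x, rfl⟩ := h.exists_eq_pair hB
    refine ⟨Set.ncard_pair (h.ne x).symm, ?_⟩
    rw [colorSum_pair (h.ne x).symm, hsign, add_neg_cancel]

theorem mem_SZero_iff (h : IsPairing p.rel σ) :
    p ∈ SZero ↔ (∀ x, normSign (σ x) = -normSign x) ∧ ∀ x, level (σ x) = level x := by
  rw [SZero, Set.mem_ofPred_eq, mem_pairNeutral_iff h]
  refine and_congr_right fun hsign => ?_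
  have hp := h.sum_eq_zero hsign
  have hclosed : ∀ x, p.colorSum (p.closedInterval x (σ x)) = level (σ x) - level x := fun x =>
    colorSum_closedInterval hp (hsign x)
  constructor
  · intro hsector x
    rw [← sub_eq_zero, ← hclosed]
    by_cases huniv : p.closedInterval x (σ x) = Set.univ
    · rw [huniv, colorSum_univ, hp]
    · exact hsector _ ⟨huniv, x, σ x, rfl, h.pair_mem_classes x⟩
  · rintro hlevel _ ⟨-, a, b, rfl, hab⟩
    have hb : σ a ∈ ({a, b} : Set p.Pt) := by
      rw [h.eq_pair_of_mem hab (Set.mem_insert a _)]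
      exact .inr rfl
    rw [← hb.resolve_left (h.ne a), hclosed, hlevel, sub_self]

theorem cross_iff_crossParity (h : IsPairing p.rel σ) {x c : p.Pt} :
    p.Cross {x, σ x} {c, σ c} ↔ c ≠ x ∧ c ≠ σ x ∧ crossParity x (σ x) c (σ c) ≠ 0 := by
  by_cases hcx : c = x
  · subst hcx
    simp [not_cross_self]
  by_cases hcσ : c = σ x
  · subst hcσ
    rw [h.involutive, Set.pair_comm (σ x)]
    simp [not_cross_self]
  have hσcσ := h.involutive.injective.ne hcx
  rw [ne_eq (crossParity _ _ _ _),
    crossParity_eq_zero_iff (h.ne x).symm hcx hcσ (mt h.apply_eq_iff.1 hcσ) hσcσ, not_not]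
  exact ⟨fun hcross => ⟨hcx, hcσ, hcross⟩, fun hcross => hcross.2.2⟩

theorem mem_I_iff_exists {D : AddSubsemigroup ℕ} :
    p ∈ I D ↔ ∃ σ, IsLevelPairing (D : Set ℕ) p.rel σ := by
  constructor
  · rintro ⟨hS, hcross⟩
    obtain ⟨σ, h⟩ := exists_isPairing_of_ncard_eq_two fun B hB => (hS.1 B hB).1
    obtain ⟨hsign, hlevel⟩ := (mem_SZero_iff h).1 hS
    refine ⟨σ, ⟨h, hsign, hlevel, fun x c hcx hcσ hD => ?_⟩⟩
    by_contra hparity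
    refine hcross _ (h.pair_mem_classes x) _ (h.pair_mem_classes c) x (.inl rfl) c (.inl rfl) ?_
      ((cross_iff_crossParity h).2 ⟨hcx, hcσ, hparity⟩)
    rwa [dist, signedDist_eq (h.sum_eq_zero hsign)]
  · rintro ⟨σ, h⟩
    refine ⟨(mem_SZero_iff h.toIsPairing).2 ⟨h.sign, h.level⟩, ?_⟩
    rintro B hB C hC x hx c hc hD
    rw [dist, signedDist_eq (h.sum_eq_zero h.sign)] at hD
    rw [h.eq_pair_of_mem hB hx, h.eq_pair_of_mem hC hc, cross_iff_crossParity h.toIsPairing]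
    exact fun ⟨hcx, hcσ, hparity⟩ => hparity (h.parity x c hcx hcσ hD)

end Membership

end ColPartition

theorem I_eq_levelPartitions (D : AddSubsemigroup ℕ) : I D = levelPartitions D :=
  Set.ext fun _ => ColPartition.mem_I_iff_exists

theorem isCategory_I (D : AddSubsemigroup ℕ) : IsCategory (I D) := by
  rw [I_eq_levelPartitions]
  exact isCategory_levelPartitions D


section Fold

variable {w : List Color}

/-- The distance of a point to the nearer end of its row. -/
def depth : Points w w → ℕ := Sum.elim (fun i => min i.val i.rev.val) fun j => min j.val j.rev.val

theorem depth_rev (x : Points w w) : depth (x.map Fin.rev Fin.rev) = depth x := by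
  rcases x with i | j <;> exact (congrArg (min _) (congrArg _ (Fin.rev_rev _))).trans (min_comm _ _)

theorem depth_swap (x : Points w w) : depth x.swap = depth x := by
  rcases x with i | j <;> rfl

theorem crossParity_swap_swap (x c : Points w w) : crossParity x x.swap c c.swap = 0 := by
  rcases x with i | i <;> rcases c with j | j <;>
    simp [crossParity, leftOf, CharTwo.add_self_eq_zero]

theorem crossParity_rev_rev {x c : Points w w} (hcx : c ≠ x) (hcr : c ≠ x.map Fin.rev Fin.rev) :
    crossParity x (x.map Fin.rev Fin.rev) c (c.map Fin.rev Fin.rev) = 0 := by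
  rw [crossParity_eq_zero_iff_lt]
  rcases x with i | i <;> rcases c with j | j <;>
    simp only [Sum.map_inl, Sum.map_inr, Sum.inl_lt_inl_iff, Sum.inr_lt_inr_iff,
      Sum.not_inl_lt_inr, Sum.not_inr_lt_inl, ne_eq, Sum.inl.injEq, Sum.inr.injEq, Fin.lt_def,
      Fin.ext_iff, Fin.val_rev] at hcx hcr ⊢ <;>
    omega

theorem crossParity_rev_swap {x c : Points w w} (h : depth c < depth x) :
    crossParity x (x.map Fin.rev Fin.rev) c c.swap = 0 := by
  rw [crossParity_eq_zero_iff_lt]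
  rcases x with i | i <;> rcases c with j | j <;>
    simp only [depth, Sum.elim_inl, Sum.elim_inr, Sum.map_inl, Sum.map_inr, Sum.swap_inl,
      Sum.swap_inr, Sum.inl_lt_inl_iff, Sum.inr_lt_inr_iff, Sum.not_inl_lt_inr, Sum.not_inr_lt_inl,
      Fin.lt_def, Fin.val_rev, iff_true, true_iff] at h ⊢ <;>
    omega

open Classical in
/-- The points whose depth lies in `S` are joined to their mirror image in the same row, the others
to the point above or below them. -/
noncomputable def foldPartner (S : Set ℕ) (x : Points w w) : Points w w :=
  if depth x ∈ S then x.map Fin.rev Fin.rev else x.swap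

variable {S : Set ℕ}

theorem foldPartner_of_mem {x : Points w w} (hx : depth x ∈ S) :
    foldPartner S x = x.map Fin.rev Fin.rev := if_pos hx

theorem foldPartner_of_notMem {x : Points w w} (hx : depth x ∉ S) : foldPartner S x = x.swap :=
  if_neg hx

theorem foldPartner_involutive (S : Set ℕ) : (foldPartner (w := w) S).Involutive := fun x => by
  by_cases hx : depth x ∈ S
  · rw [foldPartner_of_mem hx, foldPartner_of_mem (by rwa [depth_rev]), Sum.map_map,
      Fin.rev_involutive.comp_self, Sum.map_id_id, id]
  · rw [foldPartner_of_notMem hx, foldPartner_of_notMem (by rwa [depth_swap]), Sum.swap_swap]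

theorem depth_foldPartner (S : Set ℕ) (x : Points w w) : depth (foldPartner S x) = depth x := by
  rw [foldPartner]
  split_ifs
  exacts [depth_rev x, depth_swap x]

theorem crossParity_foldPartner {x c : Points w w} (hcx : c ≠ x) (hcσ : c ≠ foldPartner S x)
    (hxc : depth x ∈ S → depth c ∉ S → depth c < depth x)
    (hcx' : depth c ∈ S → depth x ∉ S → depth x < depth c) :
    crossParity x (foldPartner S x) c (foldPartner S c) = 0 := by
  have hσ := foldPartner_involutive (w := w) S
  by_cases hx : depth x ∈ S <;> by_cases hc : depth c ∈ S
  · rw [foldPartner_of_mem hx] at hcσ ⊢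
    rw [foldPartner_of_mem hc, crossParity_rev_rev hcx hcσ]
  · rw [foldPartner_of_mem hx, foldPartner_of_notMem hc, crossParity_rev_swap (hxc hx hc)]
  · rw [crossParity_points_comm hcx hcσ (mt hσ.eq_iff.1 hcσ) (hσ.injective.ne hcx),
      foldPartner_of_mem hc, foldPartner_of_notMem hx, crossParity_rev_swap (hcx' hc hx)]
  · rw [foldPartner_of_notMem hx, foldPartner_of_notMem hc, crossParity_swap_swap]

end Fold

section Mountain

/-- The word `∘ⁿ⁺¹•ⁿ⁺¹`. -/
def mountain (n : ℕ) : List Color :=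
  List.replicate (n + 1) Color.white ++ List.replicate (n + 1) Color.black

theorem length_mountain (n : ℕ) : (mountain n).length = 2 * n + 2 := by
  simp only [mountain, List.length_append, List.length_replicate]
  omega

theorem wordSum_take_mountain {n k : ℕ} (hk : k ≤ 2 * n + 2) :
    wordSum ((mountain n).take k) = min k (2 * n + 2 - k : ℕ) := by
  simp only [wordSum, mountain, List.take_append, List.take_replicate, List.length_replicate,
    List.map_append, List.map_replicate, Color.sign, List.sum_append, List.sum_replicate,
    Int.nsmul_eq_mul]
  omega

variable {n : ℕ}

theorem sign_get_mountain (i : Fin (mountain n).length) :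
    ((mountain n).get i).sign =
      (min (i + 1 : ℕ) (2 * n + 1 - i : ℕ) : ℤ) - min (i : ℕ) (2 * n + 2 - i : ℕ) := by
  have hi := i.2.trans_eq (length_mountain n)
  have hsucc := wordSum_take_succ _ i
  rw [wordSum_take_mountain (by omega), wordSum_take_mountain (by omega)] at hsucc
  omega

theorem normSign_rev (x : Points (mountain n) (mountain n)) :
    normSign (x.map Fin.rev Fin.rev) = -normSign x := by
  have hrev : ∀ i : Fin (mountain n).length,
      ((mountain n).get i.rev).sign = -((mountain n).get i).sign := fun i => by
    have hi := i.2.trans_eq (length_mountain n)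
    have hl := length_mountain n
    rw [sign_get_mountain, sign_get_mountain, Fin.val_rev]
    omega
  rcases x with i | j
  exacts [congrArg Neg.neg (hrev i), hrev j]

theorem level_mountain (x : Points (mountain n) (mountain n)) : level x = depth x := by
  have hrow : ∀ i : Fin (mountain n).length,
      rowLevel (mountain n) i = (min i.val i.rev.val : ℕ) := fun i => by
    have hi := i.2.trans_eq (length_mountain n)
    have hl := length_mountain n
    rw [rowLevel, wordSum_take_mountain (by omega), wordSum_take_mountain (by omega), Fin.val_rev]
    omega
  rcases x with i | j
  exacts [hrow i, hrow j]

theorem foldPartner_mountain_ne (S : Set ℕ) (x : Points (mountain n) (mountain n)) :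
    foldPartner S x ≠ x := by
  have hl := length_mountain n
  rw [foldPartner]
  split_ifs <;> rcases x with i | i <;>
    simp only [Sum.map_inl, Sum.map_inr, Sum.swap_inl, Sum.swap_inr, ne_eq, Sum.inl.injEq,
      Sum.inr.injEq, reduceCtorEq, not_false_eq_true, Fin.ext_iff, Fin.val_rev] <;>
    omega

/-- The pair partition on two rows colored `∘ⁿ⁺¹•ⁿ⁺¹` in which the strings at the levels in
`D ∪ {0}` are the horizontal ones. -/
noncomputable def mountainSetoid (D : Set ℕ) (n : ℕ) : Setoid (Points (mountain n) (mountain n)) :=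
  involutionSetoid (foldPartner_involutive (insert 0 D))

theorem isPairing_mountainSetoid (D : Set ℕ) (n : ℕ) :
    IsPairing (mountainSetoid D n) (foldPartner (insert 0 D)) :=
  isPairing_involutionSetoid _ (foldPartner_mountain_ne _)

theorem isLevelPairing_mountainSetoid (D : AddSubsemigroup ℕ) (n : ℕ) :
    IsLevelPairing D (mountainSetoid D n) (foldPartner (insert 0 D)) where
  toIsPairing := isPairing_mountainSetoid D n
  sign x := by
    rw [foldPartner]
    split_ifs
    exacts [normSign_rev x, normSign_swap x]
  level x := by rw [level_mountain, level_mountain, depth_foldPartner]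
  parity x c hcx hcσ hD := by
    -- A horizontal string of level `a` crosses only vertical strings of levels `b ≥ a`, and then
    -- `b - a ∉ D`, as otherwise `b = a + (b - a) ∈ D`.
    have hlt : ∀ {a b : ℕ}, a ∈ insert 0 (D : Set ℕ) → b ∉ insert 0 (D : Set ℕ) →
        (b - a : ℤ).natAbs ∈ D → b < a := fun {a b} ha hb hD => by
      by_contra! hab
      obtain ⟨k, rfl⟩ := Nat.exists_eq_add_of_le hab
      have hk : k ∈ D := by simpa using hD
      rcases ha with rfl | ha
      exacts [hb (.inr (by simpa using hk)), hb (.inr (D.add_mem ha hk))]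
    rw [level_mountain, level_mountain] at hD
    refine crossParity_foldPartner hcx hcσ (fun hx hc => hlt hx hc hD) fun hc hx => hlt hc hx ?_
    rwa [← Int.natAbs_neg, neg_sub]

theorem not_isLevelPairing_mountainSetoid {D D' : Set ℕ} (hn : 1 ≤ n) (hD : n ∉ D) (hD' : n ∈ D')
    (σ : Points (mountain n) (mountain n) → Points (mountain n) (mountain n)) :
    ¬ IsLevelPairing D' (mountainSetoid D n) σ := by
  intro h
  obtain rfl := h.toIsPairing.unique (isPairing_mountainSetoid D n)
  have hl := length_mountain n
  set outer : Points (mountain n) (mountain n) := .inl ⟨0, by omega⟩ with houter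
  set inner : Points (mountain n) (mountain n) := .inl ⟨n, by omega⟩ with hinner
  have depth_outer : depth outer = 0 := Nat.zero_min _
  have depth_inner : depth inner = n := by
    simp only [hinner, depth, Sum.elim_inl, Fin.val_rev]
    omega
  have partner_outer : foldPartner (insert 0 D) outer = outer.map Fin.rev Fin.rev :=
    foldPartner_of_mem (depth_outer ▸ Set.mem_insert 0 D)
  have partner_inner : foldPartner (insert 0 D) inner = inner.swap :=
    foldPartner_of_notMem <| by rw [depth_inner]; exact fun h => h.elim (by omega) hD
  have hparity := h.parity outer inner ?_ ?_ ?_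
  · rw [partner_outer, partner_inner, crossParity_eq_zero_iff_lt] at hparity
    simp only [houter, hinner, Sum.map_inl, Sum.swap_inl, Sum.inl_lt_inl_iff, Sum.not_inr_lt_inl,
      Fin.lt_def, Fin.val_rev, iff_true] at hparity
    omega
  · simp only [houter, hinner, ne_eq, Sum.inl.injEq, Fin.mk.injEq]
    omega
  · rw [partner_outer]
    simp only [houter, hinner, Sum.map_inl, ne_eq, Sum.inl.injEq, Fin.ext_iff, Fin.val_rev]
    omega
  · rw [level_mountain, level_mountain, depth_outer, depth_inner]
    simpa using hD'

end Mountain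

section Infinite

theorem exists_level_bound {G : Set ColPartition} (hG : G.Finite) :
    ∃ N : ℕ, ∀ p ∈ G, ∀ x c : p.Pt, (level c - level x).natAbs < N := by
  have hfinite : (⋃ p ∈ G, Set.range fun xc : p.Pt × p.Pt =>
      (level xc.2 - level xc.1).natAbs).Finite :=
    hG.biUnion fun p _ => Set.finite_range _
  obtain ⟨N, hN⟩ := hfinite.bddAbove
  exact ⟨N + 1, fun p hp x c => Nat.lt_succ_of_le (hN (Set.mem_biUnion hp ⟨(x, c), rfl⟩))⟩

theorem exists_subset_levelPartitions_union {D : Set ℕ} {G : Set ColPartition} (hG : G.Finite)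
    (hGD : G ⊆ levelPartitions D) : ∃ N : ℕ, G ⊆ levelPartitions (D ∪ Set.Ici N) := by
  obtain ⟨N, hN⟩ := exists_level_bound hG
  refine ⟨N, fun p hp => ?_⟩
  obtain ⟨σ, h⟩ := hGD hp
  refine ⟨σ, h.toIsPairing, h.sign, h.level, fun x c hcx hcσ hD => ?_⟩
  exact h.parity x c hcx hcσ (hD.resolve_right (hN p hp x c).not_ge)

theorem infinite_of_generated_eq_I {D : AddSubsemigroup ℕ} (hD : {n : ℕ | 1 ≤ n ∧ n ∉ D}.Infinite)
    {G : Set ColPartition} (hG : generated G = I D) : G.Infinite := by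
  intro hfinite
  rw [I_eq_levelPartitions] at hG
  obtain ⟨hmem, hle⟩ := hG ▸ isLeast_generated G
  obtain ⟨N, hN⟩ := exists_subset_levelPartitions_union hfinite hmem.2
  obtain ⟨n, ⟨hn, hnD⟩, hNn⟩ := hD.exists_gt N
  obtain ⟨σ, hσ⟩ := hle ⟨isCategory_levelPartitions _, hN⟩
    (show ColPartition.mk _ _ (mountainSetoid D n) ∈ _ from ⟨_, isLevelPairing_mountainSetoid D n⟩)
  exact not_isLevelPairing_mountainSetoid hn hnD (.inr hNn.le) σ hσ

end Infinite

end TwoColored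

theorem mainTheorem5_general (D : AddSubsemigroup ℕ) :
    TwoColored.IsCategory (TwoColored.I D) ∧
      ({n : ℕ | 1 ≤ n ∧ n ∉ D}.Infinite → ∀ G : Set TwoColored.ColPartition,
        TwoColored.generated G = TwoColored.I D → G.Infinite) :=
  ⟨TwoColored.isCategory_I D, fun hD _ hG => TwoColored.infinite_of_generated_eq_I hD hG⟩

theorem mainTheorem5 :
    (∀ D : AddSubsemigroup ℕ, {n : ℕ | 1 ≤ n ∧ n ∉ D}.Infinite →
      TwoColored.IsCategory (TwoColored.I D) ∧
      ∀ G : Set TwoColored.ColPartition,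
        TwoColored.generated G = TwoColored.I D → G.Infinite) ∧
    (∃ C : Set TwoColored.ColPartition, TwoColored.IsCategory C ∧
      ∀ G : Set TwoColored.ColPartition, TwoColored.generated G = C → G.Infinite) := by
  refine ⟨fun D hD => (mainTheorem5_general D).imp_right fun h => h hD, TwoColored.I ⊥,
    (mainTheorem5_general ⊥).imp_right fun h => h ?_⟩
  exact (Set.Ici_infinite 1).mono fun _ hn => ⟨hn, AddSubsemigroup.notMem_bot⟩
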